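/- Let $n,N\in\mathbb N$ with $N\ge 2$, let $\mathcal X_1,\dots,\mathcal X_n$ be measurable spaces, and let $(\Theta,\rho)$ be a pseudo-metric space with a $\sigma$-algebra containing its open sets. Let $\mathcal P$ be a family of product probability measures $P=\mu^{(1)}\times\cdots\times\mu^{(n)}$ on $\mathcal X_1\times\cdots\times\mathcal X_n$, and let $\theta(P)\in\Theta$ be the parameter associated with $P\in\mathcal P$. Let $\varepsilon>0$ and $\delta\in[0,1)$. A randomized algorithm is a Markov kernel $A$ from $\mathcal X_1\times\cdots\times\mathcal X_n$ to $\Theta$. It is $(\varepsilon,\delta)$-differentially private over $\mathcal P$ if for all $P=\mu^{(1)}\times\cdots\times\mu^{(n)}\in\mathcal P$, all $k\in[n]$ and all measurable $E\subset\Theta$, almost surely $$\mathbb P\big(A(X)\in E\mid X\big)\le e^{\varepsilon}\,\mathbb P\big(A(X')\in E\mid X'\big)+\delta ,$$ where $X\sim P$ and the neighbouring dataset $X'$ is obtained from $X$ by replacing its $k$-th entry with an independent copy drawn from $\mu^{(k)}$. (In particular this holds if the inequality is true for every dataset and every replacement of one entry.) Let $\mathcal A_{\varepsilon,\delta}(\mathcal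 P)$ be the class of all such algorithms. Let $P_1,\dots,P_N\in\mathcal P$, $P_i=\mu_i^{(1)}\times\cdots\times\mu_i^{(n)}$, and let $\rho_0,l_0,t_0>0$ be constants such that for all $i\ne i'$ in $[N]$ $$\rho\big(\theta(P_i),\theta(P_{i'})\big)\ge\rho_0,\qquad \mathrm{KL}(P_i\,\|\,P_{i'})\le l_0,\qquad \sum_{k\in[n]}\mathrm{TV}\big(\mu_i^{(k)},\mu_{i'}^{(k)}\big)\le t_0 ,$$ where $\mathrm{TV}(\mu,\nu)=\sup_E|\mu(E)-\nu(E)|$. Then $$\inf_{A\in\mathcal A_{\varepsilon,\delta}(\mathcal P)}\ \sup_{P\in\mathcal P}\ \mathbb E\,\rho\big(A(X),\theta(P)\big)\ \ge\ \max\left\{\frac{\rho_0}{2}\left(1-\frac{l_0+\log 2}{\log N}\right),\ \frac{\rho_0}{4}\left(1\wedge\frac{N-1}{e^{4\varepsilon t_0}}\right)\left(1-\frac{2\delta e^{4\varepsilon t_0}}{e^{\varepsilon}-1}\right)\right\},$$ where the expectation is over $X\sim P$ and the randomness of $A$, and may be $+\infty$. -/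

import Mathlib

open MeasureTheory ProbabilityTheory

namespace DPFano

/-- Total variation distance `sup_E |μ(E) - ν(E)|`, the supremum over measurable sets `E`. -/
noncomputable def tvDist {α : Type*} [MeasurableSpace α] (μ ν : Measure α) : ℝ :=
  ⨆ E : {E : Set α // MeasurableSet E}, |μ.real E.1 - ν.real E.1|

/-- The product measure `μ⁽¹⁾ × ⋯ × μ⁽ⁿ⁾` on datasets. A family of product probability measures
is given below as a set of tuples of marginals, which a product probability measure determines. -/
noncomputable def prodLaw {n : ℕ} {𝒳 : Fin n → Type*} [∀ k, MeasurableSpace (𝒳 k)]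
    (P : ∀ k, ProbabilityMeasure (𝒳 k)) : Measure (∀ k, 𝒳 k) :=
  Measure.pi fun k => (P k : Measure (𝒳 k))

/-- The randomized algorithm `A` (a Markov kernel from datasets to `Θ`) is `(ε, δ)`-differentially
private for all `X ∼ P ∈ 𝓟`: for every `P ∈ 𝓟`, every `k` and every measurable `E`, almost surely
`ℙ(A(X) ∈ E | X) ≤ e^ε ℙ(A(X') ∈ E | X') + δ`, where `X ∼ P` and the neighbouring dataset `X'`
arises from `X` by replacing the `k`-th datum with an independent copy. This holds in particular if
the inequality is true for every dataset and every replacement of one datum. -/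
def IsDPOver {n : ℕ} {𝒳 : Fin n → Type*} [∀ k, MeasurableSpace (𝒳 k)]
    {Θ : Type*} [MeasurableSpace Θ] (𝓟 : Set (∀ k, ProbabilityMeasure (𝒳 k))) (ε δ : ℝ)
    (A : Kernel (∀ k, 𝒳 k) Θ) : Prop :=
  ∀ P ∈ 𝓟, ∀ k : Fin n, ∀ E : Set Θ, MeasurableSet E →
    ∀ᵐ z ∂((prodLaw P).prod (P k : Measure (𝒳 k))),
      A z.1 E ≤ ENNReal.ofReal (Real.exp ε) * A (Function.update z.1 k z.2) E + ENNReal.ofReal δ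

/-- The class of `(ε, δ)`-DP randomized algorithms over the family `𝓟` with values in `Θ`. -/
def dpAlgorithms {n : ℕ} {𝒳 : Fin n → Type*} [∀ k, MeasurableSpace (𝒳 k)]
    (Θ : Type*) [MeasurableSpace Θ] (𝓟 : Set (∀ k, ProbabilityMeasure (𝒳 k))) (ε δ : ℝ) :
    Set (Kernel (∀ k, 𝒳 k) Θ) :=
  {A | IsMarkovKernel A ∧ IsDPOver 𝓟 ε δ A}

/-- The expected loss `𝔼 ρ(A(X), θ₀)`, over `X ∼ P` and the randomness of `A`. -/
noncomputable def risk {n : ℕ} {𝒳 : Fin n → Type*} [∀ k, MeasurableSpace (𝒳 k)]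
    {Θ : Type*} [PseudoMetricSpace Θ] [MeasurableSpace Θ]
    (A : Kernel (∀ k, 𝒳 k) Θ) (P : ∀ k, ProbabilityMeasure (𝒳 k)) (θ₀ : Θ) : ENNReal :=
  ∫⁻ x, ∫⁻ a, edist a θ₀ ∂(A x) ∂(prodLaw P)

/-- The minimax risk `inf_A sup_{P ∈ 𝓟} 𝔼 ρ(A(X), θ(P))` over `(ε, δ)`-DP algorithms. -/
noncomputable def dpMinimaxRisk {n : ℕ} {𝒳 : Fin n → Type*} [∀ k, MeasurableSpace (𝒳 k)]
    {Θ : Type*} [PseudoMetricSpace Θ] [MeasurableSpace Θ]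
    (𝓟 : Set (∀ k, ProbabilityMeasure (𝒳 k))) (θ : 𝓟 → Θ) (ε δ : ℝ) : ENNReal :=
  ⨅ A ∈ dpAlgorithms Θ 𝓟 ε δ, ⨆ P : 𝓟, risk A P.1 (θ P)

end DPFano

/-! The balls `B i` of radius ρ₀/2 around the parameters are disjoint. With `p i j` the probability
under `P j` that the output lies in `B i`, Markov's inequality bounds the risk at `P i` below by
ρ₀/2 · (1 - `p i i`), and disjointness gives ∑ᵢ `p i j` ≤ 1. So it suffices to find one i with `p i
i` small.

For the KL bound, `exists_integral_le_fano` applies a Donsker–Varadhan inequality to each pair of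
laws. For the privacy bound, either some `p i i` ≤ 1/2, or every ball B j has mass above 1/2 under
`P j`. In the latter case `IsDPOver.half_mul_exp_sub_le_integral` carries part of that mass to one
fixed law `P i₀`, and the N - 1 foreign balls leave little room for `p i₀ i₀`.

The transfer needs no coupling. A truncated logarithm turns the multiplicative privacy bound into an
additive oscillation bound, and marginals are then exchanged one at a time, each at cost ε · TV
(`integral_pi_sub_le`). -/

namespace DPFano

/-! ### A truncated logarithm. -/

/-- The concave function that is linear on `[0, 1]` and `1 + log v` beyond. -/
noncomputable def linLog (v : ℝ) : ℝ := if v ≤ 1 then v else 1 + Real.log v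

theorem measurable_linLog : Measurable linLog :=
  Measurable.ite measurableSet_Iic measurable_id (Real.measurable_log.const_add 1)

theorem linLog_nonneg {v : ℝ} (hv : 0 ≤ v) : 0 ≤ linLog v := by
  unfold linLog
  split_ifs with h
  · exact hv
  · have := Real.log_nonneg (not_le.mp h).le
    linarith

theorem linLog_le_self (v : ℝ) : linLog v ≤ v := by
  unfold linLog
  split_ifs with h
  · exact le_rfl
  · have := Real.log_le_sub_one_of_pos (zero_lt_one.trans (not_le.mp h))
    linarith

/-- The function is increasing and v · `linLog`′(v) = min(v, 1) ≤ 1, so scaling by e^ε adds at most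
ε. The linear piece keeps this true down to 0, where `log` is unbounded. -/
theorem linLog_le_add {u v ε : ℝ} (hu : 0 ≤ u) (hε : 0 ≤ ε)
    (h : u ≤ Real.exp ε * v) : linLog u ≤ linLog v + ε := by
  unfold linLog
  split_ifs with h1 h2 h2
  · have h3 : Real.exp (-ε) * u ≤ v := by
      rw [Real.exp_neg, inv_mul_le_iff₀ (Real.exp_pos _)]
      exact h
    nlinarith [Real.add_one_le_exp (-ε)]
  · have := Real.log_nonneg (not_le.mp h2).le
    linarith
  · have hu1 : 1 < u := not_le.mp h1
    have hv : 0 < v := pos_of_mul_pos_right (by linarith) (Real.exp_pos ε).le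
    have h3 := Real.log_le_log (by linarith) h
    rw [Real.log_mul (Real.exp_ne_zero _) hv.ne', Real.log_exp] at h3
    have := Real.log_le_sub_one_of_pos hv
    linarith
  · have hv : 0 < v := by linarith [not_le.mp h2]
    have h3 := Real.log_le_log (by linarith [not_le.mp h1]) h
    rw [Real.log_mul (Real.exp_ne_zero _) hv.ne', Real.log_exp] at h3
    linarith

/-- For l ≥ 0 this is concavity: the left side is the chord over [0, 1], as `linLog` takes the
values 0 at 0 and 1 + l at e^l. -/
theorem mul_le_linLog {u l : ℝ} (hu : 0 ≤ u) (hu1 : u ≤ 1) :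
    (1 + l) * u ≤ linLog (u * Real.exp l) := by
  unfold linLog
  split_ifs with h
  · nlinarith [Real.add_one_le_exp l]
  · have hpos : 0 < u := pos_of_mul_pos_left (by linarith [not_le.mp h]) (Real.exp_pos l).le
    have h1 := Real.log_nonneg (not_le.mp h).le
    have h2 := Real.log_nonpos hu hu1
    rw [Real.log_mul hpos.ne' (Real.exp_ne_zero _), Real.log_exp] at *
    have h3 := Real.add_one_le_exp (-Real.log u)
    rw [Real.exp_neg, Real.exp_log hpos] at h3
    have h4 : u * (-Real.log u + 1) ≤ 1 := by
      calc u * (-Real.log u + 1) ≤ u * u⁻¹ := by gcongr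
        _ = 1 := mul_inv_cancel₀ hpos.ne'
    have h5 : (1 + l) ≤ (1 + (Real.log u + l)) * (-Real.log u + 1) := by nlinarith
    nlinarith [mul_le_mul_of_nonneg_left h5 hu, mul_le_mul_of_nonneg_left h4 (by linarith : 0 ≤ 1 + (Real.log u + l))]

/-! ### Total variation and functions of bounded oscillation. -/

theorem abs_sub_le_tvDist {α : Type*} [MeasurableSpace α] (μ ν : Measure α)
    [IsProbabilityMeasure μ] [IsProbabilityMeasure ν] {E : Set α} (hE : MeasurableSet E) :
    |μ.real E - ν.real E| ≤ tvDist μ ν := by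
  refine le_ciSup (f := fun E : {E : Set α // MeasurableSet E} => |μ.real E.1 - ν.real E.1|)
    ⟨1, ?_⟩ ⟨E, hE⟩
  rintro _ ⟨F, rfl⟩
  have h1 : μ.real F.1 ≤ 1 := measureReal_le_one
  have h2 : ν.real F.1 ≤ 1 := measureReal_le_one
  have h3 : 0 ≤ μ.real F.1 := measureReal_nonneg
  have h4 : 0 ≤ ν.real F.1 := measureReal_nonneg
  exact abs_le.2 ⟨by linarith, by linarith⟩

theorem integrable_of_mem_Icc {α : Type*} [MeasurableSpace α] {μ : Measure α} [IsFiniteMeasure μ]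
    {f : α → ℝ} (hf : Measurable f) {a b : ℝ} (h : ∀ x, f x ∈ Set.Icc a b) : Integrable f μ :=
  Integrable.of_mem_Icc a b hf.aemeasurable (.of_forall h)

/-- A function of essential oscillation at most `ε` has expectations that differ by at most `ε`
times the total variation distance. -/
theorem integral_sub_le_mul_tvDist {α : Type*} [MeasurableSpace α] {ν μ : Measure α}
    [IsProbabilityMeasure ν] [IsProbabilityMeasure μ] (hac : μ ≪ ν) {φ : α → ℝ}
    (hφ : Measurable φ) {C ε : ℝ} (hb : ∀ x, φ x ∈ Set.Icc 0 C) (hε : 0 ≤ ε)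
    (hosc : ∀ᵐ x ∂ν, ∀ᵐ y ∂ν, φ x ≤ φ y + ε) :
    ∫ x, φ x ∂ν - ∫ x, φ x ∂μ ≤ ε * tvDist ν μ := by
  have hbdd : Filter.IsBoundedUnder (· ≥ ·) (ae ν) φ := Filter.isBoundedUnder_of ⟨0, fun x => (hb x).1⟩
  have hcob : Filter.IsCoboundedUnder (· ≥ ·) (ae ν) φ :=
    Filter.IsBoundedUnder.isCoboundedUnder_ge (Filter.isBoundedUnder_of ⟨C, fun x => (hb x).2⟩)
  set m := essInf φ ν
  have hlow : ∀ᵐ x ∂ν, m ≤ φ x := ae_essInf_le hbdd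
  have hup : ∀ᵐ x ∂ν, φ x ≤ m + ε := by
    filter_upwards [hosc] with x hx
    have : φ x - ε ≤ m := le_essInf_of_ae_le _ (by
      filter_upwards [hx] with y hy
      linarith) hcob
    linarith
  -- Layer cake for φ - m, which lies in [0, ε] almost everywhere; only levels in (0, ε] contribute,
  -- and each level set costs at most one TV distance.
  have key : ∀ ξ : Measure α, IsProbabilityMeasure ξ → ξ ≪ ν →
      ∫ x, φ x ∂ξ - m = ∫ t in Set.Ioc 0 ε, ξ.real {a | t ≤ φ a - m} := by
    intro ξ _ hξ
    have hi : Integrable φ ξ := integrable_of_mem_Icc hφ hb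
    rw [← (hi.sub (integrable_const m)).integral_eq_integral_Ioc_meas_le
      (f := fun a => φ a - m), integral_sub hi (integrable_const m)]
    · simp
    · filter_upwards [hξ.ae_le hlow] with x hx
      exact sub_nonneg.2 hx
    · filter_upwards [hξ.ae_le hup] with x hx
      linarith
  have hint : ∀ ξ : Measure α, IsProbabilityMeasure ξ →
      IntegrableOn (fun t => ξ.real {a | t ≤ φ a - m}) (Set.Ioc 0 ε) := by
    intro ξ _
    have hanti : Antitone (fun t => ξ.real {a | t ≤ φ a - m}) := fun s t hst =>
      measureReal_mono fun a (ha : t ≤ φ a - m) => hst.trans ha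
    exact integrable_of_mem_Icc hanti.measurable (a := 0) (b := 1)
      fun t => ⟨measureReal_nonneg, measureReal_le_one⟩
  have hν := key ν inferInstance Measure.AbsolutelyContinuous.rfl
  have hμ := key μ inferInstance hac
  calc ∫ x, φ x ∂ν - ∫ x, φ x ∂μ
      = ∫ t in Set.Ioc 0 ε, (ν.real {a | t ≤ φ a - m} - μ.real {a | t ≤ φ a - m}) := by
        rw [integral_sub (hint ν inferInstance) (hint μ inferInstance), ← hν, ← hμ]
        ring
    _ ≤ ∫ _ in Set.Ioc 0 ε, tvDist ν μ := by
        refine integral_mono ((hint ν inferInstance).sub (hint μ inferInstance))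
          (integrable_const _) fun t => ?_
        exact (le_abs_self _).trans (abs_sub_le_tvDist ν μ
          (measurableSet_le measurable_const (hφ.sub_const m)))
    _ = ε * tvDist ν μ := by simp [hε]

/-! ### Exchanging the marginals of product measures. -/

section Product

variable {ι : Type*} [DecidableEq ι] {𝒳 : ι → Type*} [∀ k, MeasurableSpace (𝒳 k)]

/-- The marginals on `s` are those of `μ`, the others those of `ν`. -/
noncomputable def hybrid (ν μ : ∀ k, Measure (𝒳 k)) (s : Finset ι) (k : ι) : Measure (𝒳 k) :=
  if k ∈ s then μ k else ν k

instance (ν μ : ∀ k, Measure (𝒳 k)) [∀ k, IsProbabilityMeasure (ν k)]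
    [∀ k, IsProbabilityMeasure (μ k)] (s : Finset ι) (k : ι) :
    IsProbabilityMeasure (hybrid ν μ s k) := by
  unfold hybrid
  split_ifs <;> infer_instance

theorem hybrid_insert (ν μ : ∀ k, Measure (𝒳 k)) (s : Finset ι) (k : ι) :
    hybrid ν μ (insert k s) = Function.update (hybrid ν μ s) k (μ k) := by
  ext1 j
  rcases eq_or_ne j k with rfl | hj
  · simp [hybrid]
  · simp [hybrid, hj]

variable [Fintype ι]

/-- Resampling one coordinate of a product measure. -/
theorem map_update_prod_pi (Q : ∀ k, Measure (𝒳 k)) [∀ k, IsProbabilityMeasure (Q k)] (k : ι)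
    (ρ : Measure (𝒳 k)) [IsProbabilityMeasure ρ] :
    ((Measure.pi Q).prod ρ).map (fun p => Function.update p.1 k p.2) =
      Measure.pi (Function.update Q k ρ) := by
  have hprob : ∀ j, IsProbabilityMeasure (Function.update Q k ρ j) := by
    intro j
    rcases eq_or_ne j k with rfl | hj
    · simpa
    · rw [Function.update_of_ne hj]
      infer_instance
  symm
  refine Measure.pi_eq fun s hs => ?_
  rw [Measure.map_apply measurable_update' (MeasurableSet.univ_pi hs)]
  have : (fun p : (∀ i, 𝒳 i) × 𝒳 k => Function.update p.1 k p.2) ⁻¹' Set.univ.pi s =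
      (Set.univ.pi (Function.update s k Set.univ)) ×ˢ s k := by
    ext ⟨x, y⟩
    simp only [Set.mem_preimage, Set.mem_pi, Set.mem_univ, true_implies, Set.mem_prod]
    constructor
    · intro h
      refine ⟨fun i => ?_, by simpa using h k⟩
      rcases eq_or_ne i k with rfl | hi
      · simp
      · simpa [hi] using h i
    · rintro ⟨h, hy⟩ i
      rcases eq_or_ne i k with rfl | hi
      · simpa
      · simpa [hi] using h i
  rw [this, Measure.prod_prod, Measure.pi_pi, ← Finset.mul_prod_erase _ _ (Finset.mem_univ k),
    ← Finset.mul_prod_erase _ _ (Finset.mem_univ k)]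
  simp only [Function.update_self, measure_univ, one_mul]
  rw [mul_comm]
  congr 1
  refine Finset.prod_congr rfl fun i hi => ?_
  simp [(Finset.mem_erase.1 hi).1]

/-- Privacy is known only almost surely under `Measure.pi ν`; this carries it to the intermediate
products. -/
theorem pi_hybrid_absolutelyContinuous (ν μ : ∀ k, Measure (𝒳 k))
    [∀ k, IsProbabilityMeasure (ν k)] [∀ k, IsProbabilityMeasure (μ k)]
    (hac : ∀ k, μ k ≪ ν k) (s : Finset ι) :
    Measure.pi (hybrid ν μ s) ≪ Measure.pi ν := by
  induction s using Finset.induction_on with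
  | empty =>
    have h1 : hybrid ν μ ∅ = ν := by ext1 k; simp [hybrid]
    rw [h1]
  | insert k s _ ih =>
    have h2 : Measure.pi ν = ((Measure.pi ν).prod (ν k)).map
        (fun p => Function.update p.1 k p.2) := by
      rw [map_update_prod_pi, Function.update_eq_self]
    rw [hybrid_insert, ← map_update_prod_pi, h2]
    exact (ih.prod (hac k)).map measurable_update'

theorem integral_pi_update (Q : ∀ k, Measure (𝒳 k)) [∀ k, IsProbabilityMeasure (Q k)] (k : ι)
    (ρ : Measure (𝒳 k)) [IsProbabilityMeasure ρ] {W : (∀ k, 𝒳 k) → ℝ} (hW : Measurable W) {C : ℝ}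
    (hb : ∀ x, W x ∈ Set.Icc 0 C) :
    ∫ x, W x ∂(Measure.pi (Function.update Q k ρ)) =
      ∫ x, ∫ y, W (Function.update x k y) ∂ρ ∂(Measure.pi Q) := by
  rw [← map_update_prod_pi, integral_map measurable_update'.aemeasurable
    hW.aestronglyMeasurable, integral_prod]
  exact integrable_of_mem_Icc (hW.comp measurable_update') fun _ => hb _

/-- If resampling a coordinate changes `W` by at most `ε`, then the expectations of `W` under two
product measures differ by at most `ε` times the sum of the total variation distances. -/
theorem integral_pi_sub_le (ν μ : ∀ k, Measure (𝒳 k))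
    [∀ k, IsProbabilityMeasure (ν k)] [∀ k, IsProbabilityMeasure (μ k)]
    (hac : ∀ k, μ k ≪ ν k) {W : (∀ k, 𝒳 k) → ℝ} (hW : Measurable W) {C ε : ℝ}
    (hb : ∀ x, W x ∈ Set.Icc 0 C) (hε : 0 ≤ ε)
    (hosc : ∀ k, ∀ᵐ z ∂((Measure.pi ν).prod (ν k)), W z.1 ≤ W (Function.update z.1 k z.2) + ε) :
    ∫ x, W x ∂(Measure.pi ν) - ∫ x, W x ∂(Measure.pi μ) ≤ ε * ∑ k, tvDist (ν k) (μ k) := by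
  suffices h : ∀ s : Finset ι, ∫ x, W x ∂(Measure.pi ν) - ∫ x, W x ∂(Measure.pi (hybrid ν μ s)) ≤
      ε * ∑ k ∈ s, tvDist (ν k) (μ k) by
    have h1 : hybrid ν μ Finset.univ = μ := by ext1 k; simp [hybrid]
    simpa only [h1] using h Finset.univ
  intro s
  induction s using Finset.induction_on with
  | empty =>
    have h1 : hybrid ν μ ∅ = ν := by ext1 k; simp [hybrid]
    simp [h1]
  | insert k s hk ih =>
    have hself : Function.update (hybrid ν μ s) k (ν k) = hybrid ν μ s := by
      rw [Function.update_eq_self_iff]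
      simp [hybrid, hk]
    have hmap : Measure.pi ν = ((Measure.pi ν).prod (ν k)).map
        (fun p => Function.update p.1 k p.2) := by
      rw [map_update_prod_pi, Function.update_eq_self]
    -- Resampling coordinate k of x itself preserves the law, so the bound compares two independent
    -- values y, y' of that coordinate. This is the essential oscillation.
    have h1 : ∀ᵐ x ∂(Measure.pi ν), ∀ᵐ y ∂(ν k), ∀ᵐ y' ∂(ν k),
        W (Function.update x k y) ≤ W (Function.update x k y') + ε := by
      have h := Measure.ae_ae_of_ae_prod (hosc k)
      rw [hmap] at h
      have h' := Measure.ae_ae_of_ae_prod (ae_of_ae_map measurable_update'.aemeasurable h)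
      simpa only [Function.update_idem] using h'
    have hint : ∀ ρ : Measure (𝒳 k), IsProbabilityMeasure ρ → Integrable
        (fun x => ∫ y, W (Function.update x k y) ∂ρ) (Measure.pi (hybrid ν μ s)) := by
      intro ρ _
      exact (integrable_of_mem_Icc (μ := (Measure.pi (hybrid ν μ s)).prod ρ)
        (hW.comp measurable_update') fun _ => hb _).integral_prod_left
    have h2 : ∫ x, W x ∂(Measure.pi (hybrid ν μ s)) -
        ∫ x, W x ∂(Measure.pi (hybrid ν μ (insert k s))) ≤ ε * tvDist (ν k) (μ k) := by
      rw [hybrid_insert, integral_pi_update _ _ _ hW hb]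
      nth_rewrite 1 [← hself]
      rw [integral_pi_update _ _ _ hW hb,
        ← integral_sub (hint _ inferInstance) (hint _ inferInstance)]
      calc _ ≤ ∫ _, ε * tvDist (ν k) (μ k) ∂(Measure.pi (hybrid ν μ s)) := by
            refine integral_mono_ae ((hint _ inferInstance).sub (hint _ inferInstance))
              (integrable_const _) ?_
            filter_upwards [(pi_hybrid_absolutelyContinuous ν μ hac s).ae_le h1] with x hx
            exact integral_sub_le_mul_tvDist (hac k) (hW.comp (measurable_update x)) (fun _ => hb _)
              hε hx
        _ = _ := by simp
    rw [Finset.sum_insert hk]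
    linarith

/-- Transfer of probability between product measures under pure differential privacy. -/
theorem half_mul_exp_le_integral (ν μ : ∀ k, Measure (𝒳 k))
    [∀ k, IsProbabilityMeasure (ν k)] [∀ k, IsProbabilityMeasure (μ k)]
    (hac : ∀ k, μ k ≪ ν k) {G : (∀ k, 𝒳 k) → ℝ} (hG : Measurable G) {ε t : ℝ}
    (hb : ∀ x, G x ∈ Set.Icc 0 1) (hε : 0 ≤ ε) (ht : 0 ≤ t)
    (hdp : ∀ k, ∀ᵐ z ∂((Measure.pi ν).prod (ν k)),
      G z.1 ≤ Real.exp ε * G (Function.update z.1 k z.2))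
    (htv : ∑ k, tvDist (ν k) (μ k) ≤ t) (hhalf : 1 / 2 ≤ ∫ x, G x ∂(Measure.pi ν)) :
    1 / 2 * Real.exp (-(2 * ε * t)) ≤ ∫ x, G x ∂(Measure.pi μ) := by
  -- Chosen so that the exchange cost ε t equals l/2, the gain of (1 + l) · 1/2 over 1/2.
  set l := 2 * ε * t with hl
  have hl0 : 0 ≤ l := by positivity
  have hG0 : ∀ x, 0 ≤ G x * Real.exp l := fun x => mul_nonneg (hb x).1 (Real.exp_pos _).le
  have hW : Measurable fun x => linLog (G x * Real.exp l) :=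
    measurable_linLog.comp (hG.mul_const _)
  have hWb : ∀ x, linLog (G x * Real.exp l) ∈ Set.Icc 0 (Real.exp l) := fun x =>
    ⟨linLog_nonneg (hG0 x), (linLog_le_self _).trans
      (mul_le_of_le_one_left (Real.exp_pos _).le (hb x).2)⟩
  have h1 := integral_pi_sub_le ν μ hac hW hWb hε fun k => by
    filter_upwards [hdp k] with z hz
    refine linLog_le_add (hG0 _) hε ?_
    rw [← mul_assoc]
    gcongr
  have h2 : (1 + l) * ∫ x, G x ∂(Measure.pi ν) ≤
      ∫ x, linLog (G x * Real.exp l) ∂(Measure.pi ν) := by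
    rw [← integral_const_mul]
    exact integral_mono ((integrable_of_mem_Icc hG hb).const_mul _) (integrable_of_mem_Icc hW hWb)
      fun x => mul_le_linLog (hb x).1 (hb x).2
  have h3 : ∫ x, linLog (G x * Real.exp l) ∂(Measure.pi μ) ≤
      (∫ x, G x ∂(Measure.pi μ)) * Real.exp l := by
    rw [← integral_mul_const]
    exact integral_mono (integrable_of_mem_Icc hW hWb) ((integrable_of_mem_Icc hG hb).mul_const _)
      fun x => linLog_le_self _
  have h4 : 1 / 2 ≤ (∫ x, G x ∂(Measure.pi μ)) * Real.exp l := by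
    have := mul_le_mul_of_nonneg_left htv hε
    nlinarith
  rwa [Real.exp_neg, ← div_eq_mul_inv, div_le_iff₀ (Real.exp_pos _)]

end Product

/-! ### Relative entropy and Fano's inequality. -/

/-- Fenchel–Young inequality: the convex conjugate of `klFun` is f ↦ e^f - 1. -/
theorem mul_le_klFun_add_exp {x : ℝ} (hx : 0 ≤ x) (f : ℝ) :
    x * f ≤ InformationTheory.klFun x + Real.exp f - 1 := by
  rw [InformationTheory.klFun_apply]
  rcases hx.eq_or_lt with rfl | hx
  · have := Real.exp_pos f
    linarith
  · have h1 : Real.exp f = x * Real.exp (f - Real.log x) := by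
      rw [Real.exp_sub, Real.exp_log hx]
      field_simp
    have h2 := mul_le_mul_of_nonneg_left (Real.add_one_le_exp (f - Real.log x)) hx.le
    rw [h1]
    linarith

/-- A linear form of the Donsker–Varadhan inequality. -/
theorem integral_le_klDiv_add {α : Type*} [MeasurableSpace α] {μ ν : Measure α}
    [IsProbabilityMeasure μ] [IsProbabilityMeasure ν]
    (hkl : InformationTheory.klDiv μ ν ≠ ⊤) {f : α → ℝ} (hf : Measurable f) {a b : ℝ}
    (hb : ∀ x, f x ∈ Set.Icc a b) :
    ∫ x, f x ∂μ ≤ (InformationTheory.klDiv μ ν).toReal + ∫ x, Real.exp (f x) ∂ν - 1 := by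
  obtain ⟨hac, hllr⟩ := InformationTheory.klDiv_ne_top_iff.1 hkl
  have h1 : Integrable (fun x => (μ.rnDeriv ν x).toReal * f x) ν :=
    (integrable_rnDeriv_smul_iff hac).2 (integrable_of_mem_Icc hf hb)
  have h2 : Integrable (fun x => InformationTheory.klFun (μ.rnDeriv ν x).toReal) ν :=
    (InformationTheory.integrable_klFun_rnDeriv_iff hac).2 hllr
  have h3 : Integrable (fun x => Real.exp (f x)) ν :=
    integrable_of_mem_Icc (Real.measurable_exp.comp hf)
      fun x => ⟨Real.exp_le_exp.2 (hb x).1, Real.exp_le_exp.2 (hb x).2⟩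
  rw [InformationTheory.toReal_klDiv_eq_integral_klFun hac, ← integral_rnDeriv_smul hac]
  calc ∫ x, (μ.rnDeriv ν x).toReal • f x ∂ν
      ≤ ∫ x, (InformationTheory.klFun (μ.rnDeriv ν x).toReal + Real.exp (f x) - 1) ∂ν :=
        integral_mono h1 ((h2.add h3).sub (integrable_const 1))
          fun x => mul_le_klFun_add_exp ENNReal.toReal_nonneg _
    _ = _ := by
        rw [← integral_add h2 h3]
        simpa using integral_sub (h2.add h3) (integrable_const (1 : ℝ))

/-- Fano's inequality for a randomized test `g`. -/
theorem exists_integral_le_fano {α : Type*} [MeasurableSpace α] {N : ℕ} (hN : 2 ≤ N)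
    (Q : Fin N → Measure α) [∀ i, IsProbabilityMeasure (Q i)] {g : Fin N → α → ℝ}
    (hg : ∀ i, Measurable (g i)) (hb : ∀ i x, g i x ∈ Set.Icc 0 1) (hsum : ∀ x, ∑ i, g i x ≤ 1)
    {l : ℝ} (hl : 0 ≤ l)
    (hkl : ∀ i j, i ≠ j → InformationTheory.klDiv (Q i) (Q j) ≤ ENNReal.ofReal l) :
    ∃ i, ∫ x, g i x ∂(Q i) ≤ (l + Real.log 2) / Real.log N := by
  have hN1 : (1 : ℝ) < N := by exact_mod_cast hN
  have hlog : 0 < Real.log N := Real.log_pos hN1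
  have hkl' : ∀ i j, InformationTheory.klDiv (Q i) (Q j) ≤ ENNReal.ofReal l := by
    intro i j
    rcases eq_or_ne i j with rfl | h
    · simp
    · exact hkl i j h
  have hi : ∀ i j, Integrable (g i) (Q j) := fun i j => integrable_of_mem_Icc (hg i) (hb i)
  have key : ∀ i j, Real.log N * ∫ x, g i x ∂(Q i) ≤
      l + Real.log 2 + (N - 1) / 2 * ∫ x, g i x ∂(Q j) - 1 / 2 := by
    intro i j
    have h1 := integral_le_klDiv_add (μ := Q i) (ν := Q j)
      (ne_top_of_le_ne_top ENNReal.ofReal_ne_top (hkl' i j))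
      (f := fun x => Real.log N * g i x - Real.log 2) (((hg i).const_mul _).sub_const _)
      (a := -Real.log 2) (b := Real.log N - Real.log 2) fun x =>
        ⟨by nlinarith [(hb i x).1], by nlinarith [(hb i x).2]⟩
    rw [integral_sub ((hi i i).const_mul _) (integrable_const _), integral_const_mul] at h1
    have h2 : (InformationTheory.klDiv (Q i) (Q j)).toReal ≤ l :=
      ENNReal.toReal_le_of_le_ofReal hl (hkl' i j)
    -- Convexity of exp bounds N^g by its chord 1 + (N - 1) g on [0, 1]; the shift by log 2 halves
    -- it.
    have hconv : ∀ x, Real.exp (Real.log N * g i x - Real.log 2) ≤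
        1 / 2 + (N - 1) / 2 * g i x := by
      intro x
      have h := convexOn_exp.2 (Set.mem_univ 0) (Set.mem_univ (Real.log N))
        (sub_nonneg.2 (hb i x).2) (hb i x).1 (sub_add_cancel _ _)
      simp only [smul_eq_mul, mul_zero, zero_add, Real.exp_zero,
        Real.exp_log (zero_lt_one.trans hN1)] at h
      rw [Real.exp_sub, Real.exp_log two_pos, mul_comm (Real.log N)]
      linarith
    have h3 : ∫ x, Real.exp (Real.log N * g i x - Real.log 2) ∂(Q j) ≤
        1 / 2 + (N - 1) / 2 * ∫ x, g i x ∂(Q j) := by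
      calc _ ≤ ∫ x, (1 / 2 + (N - 1) / 2 * g i x) ∂(Q j) :=
            integral_mono_of_nonneg (.of_forall fun x => (Real.exp_pos _).le)
              ((integrable_const _).add ((hi i j).const_mul _)) (.of_forall hconv)
        _ = _ := by
            rw [integral_add (integrable_const _) ((hi i j).const_mul _), integral_const_mul]
            simp
    simp only [integral_const, probReal_univ, one_smul] at h1
    linarith
  have hq : ∀ j, ∑ i, ∫ x, g i x ∂(Q j) ≤ 1 := by
    intro j
    rw [← integral_finsetSum _ fun i _ => hi i j]
    calc _ ≤ ∫ _, (1 : ℝ) ∂(Q j) :=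
          integral_mono (integrable_finsetSum _ fun i _ => hi i j) (integrable_const 1) hsum
      _ = 1 := by simp
  -- If every success probability were larger, `key` would make each term exceed 1/2; summing over i
  -- at a fixed j gives N/2 < (N - 1)/2.
  by_contra! hcon
  have h1 : ∀ i j, 1 / 2 < (N - 1) / 2 * ∫ x, g i x ∂(Q j) := by
    intro i j
    have h2 := (div_lt_iff₀ hlog).1 (hcon i)
    linarith [key i j]
  have j : Fin N := ⟨0, by omega⟩
  have h2 : ∑ i : Fin N, (1 / 2 : ℝ) < ∑ i, (N - 1) / 2 * ∫ x, g i x ∂(Q j) :=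
    Finset.sum_lt_sum_of_nonempty ⟨j, Finset.mem_univ j⟩ fun i _ => h1 i j
  rw [← Finset.mul_sum] at h2
  simp only [Finset.sum_const, Finset.card_univ, Fintype.card_fin, nsmul_eq_mul] at h2
  nlinarith [hq j]

/-! ### Private algorithms and their risk. -/

section Algorithm

variable {n : ℕ} {𝒳 : Fin n → Type*} [∀ k, MeasurableSpace (𝒳 k)]
  {Θ : Type*} [MeasurableSpace Θ]

instance (P : ∀ k, ProbabilityMeasure (𝒳 k)) : IsProbabilityMeasure (prodLaw P) := by
  unfold prodLaw
  infer_instance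

theorem measurable_kernel_real (A : Kernel (∀ k, 𝒳 k) Θ) {E : Set Θ} (hE : MeasurableSet E) :
    Measurable fun x => (A x).real E :=
  (A.measurable_coe hE).ennreal_toReal

theorem kernel_real_mem_Icc (A : Kernel (∀ k, 𝒳 k) Θ) [IsMarkovKernel A] (E : Set Θ)
    (x : ∀ k, 𝒳 k) : (A x).real E ∈ Set.Icc 0 1 :=
  ⟨measureReal_nonneg, measureReal_le_one⟩

theorem absolutelyContinuous_marginal {P P' : ∀ k, ProbabilityMeasure (𝒳 k)}
    (h : prodLaw P ≪ prodLaw P') (k : Fin n) :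
    (P k : Measure (𝒳 k)) ≪ (P' k : Measure (𝒳 k)) := by
  have h1 := h.map (measurable_pi_apply k)
  rwa [prodLaw, prodLaw, (measurePreserving_eval (fun k => (P k : Measure (𝒳 k))) k).map_eq,
    (measurePreserving_eval (fun k => (P' k : Measure (𝒳 k))) k).map_eq] at h1

/-- Transfer of probability between product laws under `(ε, δ)`-differential privacy. -/
theorem IsDPOver.half_mul_exp_sub_le_integral {𝓟 : Set (∀ k, ProbabilityMeasure (𝒳 k))}
    {ε δ t : ℝ} {A : Kernel (∀ k, 𝒳 k) Θ} [IsMarkovKernel A] (hA : IsDPOver 𝓟 ε δ A)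
    (hε : 0 < ε) (hδ : 0 ≤ δ) (ht : 0 ≤ t) {P P' : ∀ k, ProbabilityMeasure (𝒳 k)} (hP : P ∈ 𝓟)
    (hac : prodLaw P' ≪ prodLaw P)
    (htv : ∑ k, tvDist (P k : Measure (𝒳 k)) (P' k : Measure (𝒳 k)) ≤ t)
    {E : Set Θ} (hE : MeasurableSet E) (hhalf : 1 / 2 ≤ ∫ x, (A x).real E ∂(prodLaw P)) :
    1 / 2 * Real.exp (-(2 * ε * t)) - δ / (Real.exp ε - 1) ≤
      ∫ x, (A x).real E ∂(prodLaw P') := by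
  have hexp : 0 < Real.exp ε - 1 := sub_pos.2 (Real.one_lt_exp_iff.2 hε)
  -- The shift that absorbs δ: since d e^ε = d + δ, adding d turns the (ε, δ) bound into a purely
  -- multiplicative one. Truncation at 1 preserves it because e^ε ≥ 1.
  set d := δ / (Real.exp ε - 1) with hd
  have hd0 : 0 ≤ d := div_nonneg hδ hexp.le
  have hdd : d * Real.exp ε = d + δ := by
    have : d * (Real.exp ε - 1) = δ := div_mul_cancel₀ _ hexp.ne'
    linarith
  have hm := measurable_kernel_real A hE
  have hbg := kernel_real_mem_Icc A E
  have hG : Measurable fun x => min 1 ((A x).real E + d) := measurable_const.min (hm.add_const d)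
  have hGb : ∀ x, min 1 ((A x).real E + d) ∈ Set.Icc (0 : ℝ) 1 := fun x =>
    ⟨le_min zero_le_one (add_nonneg (hbg x).1 hd0), min_le_left _ _⟩
  have key := half_mul_exp_le_integral (fun k => (P k : Measure (𝒳 k)))
    (fun k => (P' k : Measure (𝒳 k))) (absolutelyContinuous_marginal hac) hG hGb hε.le ht
    (fun k => by
      filter_upwards [hA P hP k E hE] with z hz
      have h1 : (A z.1).real E ≤ Real.exp ε * (A (Function.update z.1 k z.2)).real E + δ := by
        have h2 := ENNReal.toReal_mono (by finiteness) hz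
        rwa [ENNReal.toReal_add (by finiteness) (by finiteness), ENNReal.toReal_mul,
          ENNReal.toReal_ofReal (Real.exp_pos _).le, ENNReal.toReal_ofReal hδ] at h2
      rw [mul_min_of_nonneg _ _ (Real.exp_pos ε).le]
      refine min_le_min ?_ ?_
      · linarith
      · linarith)
    htv
    (hhalf.trans (integral_mono (integrable_of_mem_Icc hm hbg) (integrable_of_mem_Icc hG hGb)
      fun x => le_min (hbg x).2 (le_add_of_nonneg_right hd0)))
  have h3 : ∫ x, min 1 ((A x).real E + d) ∂(prodLaw P') ≤
      ∫ x, (A x).real E ∂(prodLaw P') + d := by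
    have hi : Integrable (fun x => (A x).real E) (prodLaw P') := integrable_of_mem_Icc hm hbg
    calc _ ≤ ∫ x, ((A x).real E + d) ∂(prodLaw P') :=
          integral_mono (integrable_of_mem_Icc hG hGb) (hi.add (integrable_const d))
            fun x => min_le_right _ _
      _ = _ := by
          rw [integral_add hi (integrable_const d)]
          simp
  exact sub_le_iff_le_add.2 (key.trans h3)

/-- Markov's inequality for the loss. -/
theorem ofReal_le_risk {Θ : Type*} [PseudoMetricSpace Θ] [MeasurableSpace Θ]
    [OpensMeasurableSpace Θ] (A : Kernel (∀ k, 𝒳 k) Θ) [IsMarkovKernel A]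
    (P : ∀ k, ProbabilityMeasure (𝒳 k)) (θ₀ : Θ) {r : ℝ} (hr : 0 ≤ r) :
    ENNReal.ofReal (r * (1 - ∫ x, (A x).real (Metric.ball θ₀ r) ∂(prodLaw P))) ≤
      risk A P θ₀ := by
  have hB : MeasurableSet (Metric.ball θ₀ r) := measurableSet_ball
  have hi : Integrable (fun x => (A x).real (Metric.ball θ₀ r)) (prodLaw P) :=
    integrable_of_mem_Icc (measurable_kernel_real A hB) (kernel_real_mem_Icc A _)
  have h1 : r * (1 - ∫ x, (A x).real (Metric.ball θ₀ r) ∂(prodLaw P)) =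
      ∫ x, r * (A x).real (Metric.ball θ₀ r)ᶜ ∂(prodLaw P) := by
    simp_rw [probReal_compl_eq_one_sub hB]
    rw [integral_const_mul, integral_sub (integrable_const 1) hi]
    simp
  rw [h1, ofReal_integral_eq_lintegral_ofReal]
  · refine lintegral_mono fun x => ?_
    rw [ENNReal.ofReal_mul hr, ofReal_measureReal, ← lintegral_indicator_const hB.compl]
    refine lintegral_mono fun a => ?_
    by_cases ha : a ∈ Metric.ball θ₀ r
    · simp [ha]
    · rw [Set.indicator_of_mem (Set.mem_compl ha), edist_dist]
      exact ENNReal.ofReal_le_ofReal (not_lt.1 ha)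
  · exact (integrable_of_mem_Icc (measurable_kernel_real A hB.compl)
      (kernel_real_mem_Icc A _)).const_mul r
  · exact .of_forall fun x => mul_nonneg hr measureReal_nonneg

end Algorithm

end DPFano

open DPFano

/-! ### The minimax lower bound. -/

theorem mainTheorem7 {n : ℕ} {𝒳 : Fin n → Type*} [∀ k, MeasurableSpace (𝒳 k)]
    {Θ : Type*} [PseudoMetricSpace Θ] [MeasurableSpace Θ] [OpensMeasurableSpace Θ]
    (𝓟 : Set (∀ k, ProbabilityMeasure (𝒳 k))) (θ : 𝓟 → Θ)
    {ε δ : ℝ} (hε : 0 < ε) (hδ : 0 ≤ δ) (hδ1 : δ < 1)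
    {N : ℕ} (hN : 2 ≤ N) (P : Fin N → 𝓟)
    {ρ₀ l₀ t₀ : ℝ} (hρ₀ : 0 < ρ₀) (hl₀ : 0 < l₀) (ht₀ : 0 < t₀)
    (hsep : ∀ i j, i ≠ j → ρ₀ ≤ dist (θ (P i)) (θ (P j)))
    (hKL : ∀ i j, i ≠ j →
      InformationTheory.klDiv (DPFano.prodLaw (P i).1) (DPFano.prodLaw (P j).1)
        ≤ ENNReal.ofReal l₀)
    (hTV : ∀ i j, i ≠ j →
      ∑ k, DPFano.tvDist ((P i).1 k : Measure (𝒳 k)) ((P j).1 k : Measure (𝒳 k)) ≤ t₀) :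
    ENNReal.ofReal
      (max (ρ₀ / 2 * (1 - (l₀ + Real.log 2) / Real.log N))
        (ρ₀ / 4 * min 1 (((N : ℝ) - 1) / Real.exp (4 * ε * t₀)) *
          (1 - 2 * δ * Real.exp (4 * ε * t₀) / (Real.exp ε - 1))))
      ≤ DPFano.dpMinimaxRisk 𝓟 θ ε δ := by
  refine le_iInf₂ fun A hA => ?_
  obtain ⟨hMarkov, hDP⟩ := hA
  set B : Fin N → Set Θ := fun i => Metric.ball (θ (P i)) (ρ₀ / 2)
  set p : Fin N → Fin N → ℝ := fun i j => ∫ x, (A x).real (B i) ∂(prodLaw (P j).1)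
  have hB : ∀ i, MeasurableSet (B i) := fun i => measurableSet_ball
  have hdisj : Pairwise (Function.onFun Disjoint B) := fun i j hij =>
    Metric.ball_disjoint_ball (by linarith [hsep i j hij])
  have hsum : ∀ x, ∑ i, (A x).real (B i) ≤ 1 := fun x => by
    rw [← measureReal_iUnion_fintype hdisj hB]
    exact measureReal_le_one
  have hint : ∀ i j, Integrable (fun x => (A x).real (B i)) (prodLaw (P j).1) := fun i j =>
    integrable_of_mem_Icc (measurable_kernel_real A (hB i)) (kernel_real_mem_Icc A _)
  suffices h : ∀ c : ℝ, (∃ i, c ≤ ρ₀ / 2 * (1 - p i i)) →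
      ENNReal.ofReal c ≤ ⨆ Q : 𝓟, risk A Q.1 (θ Q) by
    rcases max_choice (ρ₀ / 2 * (1 - (l₀ + Real.log 2) / Real.log N))
      (ρ₀ / 4 * min 1 (((N : ℝ) - 1) / Real.exp (4 * ε * t₀)) *
          (1 - 2 * δ * Real.exp (4 * ε * t₀) / (Real.exp ε - 1))) with hmax | hmax <;>
      rw [hmax] <;> refine h _ ?_
    · obtain ⟨i, hi⟩ := exists_integral_le_fano hN (fun i => prodLaw (P i).1)
        (fun i => measurable_kernel_real A (hB i)) (fun i x => kernel_real_mem_Icc A (B i) x)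
        hsum hl₀.le hKL
      exact ⟨i, mul_le_mul_of_nonneg_left (sub_le_sub_left hi 1) (by positivity)⟩
    · have hexp : 0 < Real.exp ε - 1 := sub_pos.2 (Real.one_lt_exp_iff.2 hε)
      have hN1 : (1 : ℝ) ≤ N - 1 := by
        have : (2 : ℝ) ≤ N := by exact_mod_cast hN
        linarith
      set K := Real.exp (4 * ε * t₀) with hK
      have hK0 : 0 < K := Real.exp_pos _
      set m := min 1 (((N : ℝ) - 1) / K) with hm
      have hm0 : 0 ≤ m := le_min zero_le_one (by positivity)
      set F := 1 - 2 * δ * K / (Real.exp ε - 1) with hF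
      have hF1 : F ≤ 1 := sub_le_self _ (by positivity)
      suffices h' : ∃ i, m * F / 2 ≤ 1 - p i i by
        obtain ⟨i, hi⟩ := h'
        exact ⟨i, by nlinarith [mul_le_mul_of_nonneg_left hi (by positivity : 0 ≤ ρ₀ / 2)]⟩
      -- Such an i suffices because m F ≤ 1.
      by_cases hhalf : ∃ i, p i i ≤ 1 / 2
      · obtain ⟨i, hi⟩ := hhalf
        exact ⟨i, by nlinarith [mul_le_mul_of_nonneg_left hF1 hm0, min_le_left 1 (((N : ℝ) - 1) / K)]⟩
      push Not at hhalf
      have i₀ : Fin N := ⟨0, by omega⟩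
      refine ⟨i₀, ?_⟩
      set d := δ / (Real.exp ε - 1) with hd
      have h1 : ∀ j ∈ Finset.univ.erase i₀, 1 / 2 * K⁻¹ - d ≤ p j i₀ := by
        intro j hj
        have hji := (Finset.mem_erase.1 hj).1
        -- Finite KL divergence supplies the absolute continuity that the transfer needs.
        have hac : prodLaw (P i₀).1 ≪ prodLaw (P j).1 :=
          (InformationTheory.klDiv_ne_top_iff.1
            (ne_top_of_le_ne_top ENNReal.ofReal_ne_top (hKL i₀ j hji.symm))).1
        have h2 := hDP.half_mul_exp_sub_le_integral hε hδ ht₀.le (P j).2 hac (hTV j i₀ hji) (hB j)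
          (hhalf j).le
        -- The transfer gives exponent 2εt₀, stronger than the required 4εt₀.
        refine le_trans ?_ h2
        rw [hK, ← Real.exp_neg]
        gcongr
        norm_num
      have h3 : ∑ j, p j i₀ ≤ 1 := by
        rw [← integral_finsetSum _ fun i _ => hint i i₀]
        calc _ ≤ ∫ _, (1 : ℝ) ∂(prodLaw (P i₀).1) :=
              integral_mono (integrable_finsetSum _ fun i _ => hint i i₀) (integrable_const 1) hsum
          _ = 1 := by simp
      have h4 := Finset.card_nsmul_le_sum _ _ _ h1
      rw [← Finset.add_sum_erase _ _ (Finset.mem_univ i₀)] at h3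
      rw [Finset.card_erase_of_mem (Finset.mem_univ _), Finset.card_univ, Fintype.card_fin,
        nsmul_eq_mul, Nat.cast_sub (by omega), Nat.cast_one] at h4
      have h5 : (N - 1) * (1 / 2 * K⁻¹ - d) = (N - 1) / K * F / 2 := by
        rw [hF, hd]
        field_simp
      have hp : p i₀ i₀ ≤ 1 := by
        have := Finset.sum_nonneg fun j (_ : j ∈ Finset.univ.erase i₀) =>
          (integral_nonneg fun x => measureReal_nonneg : 0 ≤ p j i₀)
        linarith
      -- For F ≤ 0 the bound is trivial; otherwise m ≤ (N - 1)/K may be multiplied by F and compared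
      -- with the mass of the foreign balls.
      rcases le_total F 0 with hF0 | hF0
      · nlinarith
      · have := mul_le_mul_of_nonneg_right (min_le_right 1 (((N : ℝ) - 1) / K)) hF0
        linarith
  rintro c ⟨i, hi⟩
  exact ((ENNReal.ofReal_le_ofReal hi).trans
    (ofReal_le_risk A (P i).1 (θ (P i)) (by positivity))).trans
    (le_iSup (fun Q : 𝓟 => risk A Q.1 (θ Q)) (P i))
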